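/- Let $k\ge 1$ and $n\ge 0$ be integers, let $-\infty\le a\le b\le\infty$, and let $\phi_{si}$ $(1\le s\le 2k,\ 1\le i\le 2kn)$ be real- or complex-valued functions such that for all pairwise distinct indices $i_1,\dots,i_{2k}\in\{1,\dots,2kn\}$ the product $\phi_{1i_1}\phi_{2i_2}\cdots\phi_{2k\,i_{2k}}$ is Lebesgue integrable over the interval from $a$ to $b$. For real $x_1,\dots,x_n$ let $(\phi_{1i}(x_j)|\cdots|\phi_{2k\,i}(x_j))$ denote the $2kn\times 2kn$ matrix whose $i$-th row is $$[\phi_{1i}(x_1),\dots,\phi_{2k\,i}(x_1),\ \phi_{1i}(x_2),\dots,\phi_{2k\,i}(x_2),\ \dots,\ \phi_{1i}(x_n),\dots,\phi_{2k\,i}(x_n)].$$ For a tensor $M=(M_{i_1\cdots i_m})_{1\le i_1,\dots,i_m\le mn}$ put $$\mathrm{Pf}^{[m]}(M)=\sum_{\sigma\in\mathfrak E_{mn,m}}\epsilon(\sigma)\prod_{p=0}^{n-1}M_{\sigma(mp+1)\cdots\sigma(mp+m)},\qquad \mathrm{Hf}^{[m]}(M)=\sum_{\sigma\in\mathfrak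 E_{mn,m}}\prod_{p=0}^{n-1}M_{\sigma(mp+1)\cdots\sigma(mp+m)},$$ where $\epsilon(\sigma)$ is the signature and $\mathfrak E_{mn,m}$ is the set of permutations $\sigma$ of $\{1,\dots,mn\}$ with $\sigma(mp+1)<\sigma(mp+2)<\cdots<\sigma(mp+m)$ for $0\le p\le n-1$ and $\sigma(1)<\sigma(m+1)<\cdots<\sigma(m(n-1)+1)$. Then the determinant and the permanent of $(\phi_{1i}(x_j)|\cdots|\phi_{2k\,i}(x_j))$ are integrable over the ordered simplex $\{a\le x_1<\cdots<x_n\le b\}$, and $$\int\!\cdots\!\int_{a\le x_1<\cdots<x_n\le b}\det(\phi_{1i}(x_j)|\cdots|\phi_{2k\,i}(x_j))\,dx_1\cdots dx_n=\mathrm{Pf}^{[2k]}\left(\int_a^b\sum_{\sigma\in\mathfrak S_{2k}}\epsilon(\sigma)\,\phi_{1i_{\sigma(1)}}(x)\cdots\phi_{2k\,i_{\sigma(2k)}}(x)\,dx\right)_{1\le i_1,\dots,i_{2k}\le 2kn},$$ $$\int\!\cdots\!\int_{a\le x_1<\cdots<x_n\le b}\mathrm{per}(\phi_{1i}(x_j)|\cdots|\phi_{2k\,i}(x_j))\,dx_1\cdots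 dx_n=\mathrm{Hf}^{[2k]}\left(\int_a^b\sum_{\sigma\in\mathfrak S_{2k}}\phi_{1i_{\sigma(1)}}(x)\cdots\phi_{2k\,i_{\sigma(2k)}}(x)\,dx\right)_{1\le i_1,\dots,i_{2k}\le 2kn}.$$ -/

import Mathlib

open MeasureTheory

namespace HyperDeBruijn

/-- The permutations `σ` of the `n * m` indices, cut into `n` consecutive blocks of length `m`
(`finProdFinEquiv (p, s)` is the position `s + m * p`, that is, place `s` of block `p`), such that
`σ` increases on each block and the first entries of the blocks increase from block to block. -/
def blockPerms (m n : ℕ) : Finset (Equiv.Perm (Fin (n * m))) :=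
  Finset.univ.filter fun σ =>
    (∀ p : Fin n, ∀ s t : Fin m, s < t →
      σ (finProdFinEquiv (p, s)) < σ (finProdFinEquiv (p, t))) ∧
    (∀ p q : Fin n, p < q → ∀ s : Fin m, (s : ℕ) = 0 →
      σ (finProdFinEquiv (p, s)) < σ (finProdFinEquiv (q, s)))

/-- The hyperpfaffian `Pf^[m]` of a tensor of order `m` in dimension `n * m`. -/
def hyperpfaffian {R : Type*} [CommRing R] (m n : ℕ) (M : (Fin m → Fin (n * m)) → R) : R :=
  ∑ σ ∈ blockPerms m n, ((Equiv.Perm.sign σ : ℤ) : R) *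
    ∏ p : Fin n, M fun s => σ (finProdFinEquiv (p, s))

/-- The hyperhafnian `Hf^[m]` of a tensor of order `m` in dimension `n * m`. -/
def hyperhafnian {R : Type*} [CommRing R] (m n : ℕ) (M : (Fin m → Fin (n * m)) → R) : R :=
  ∑ σ ∈ blockPerms m n, ∏ p : Fin n, M fun s => σ (finProdFinEquiv (p, s))

/-- The matrix `(φ₁ᵢ(xⱼ) | ⋯ | φₘᵢ(xⱼ))`, whose `i`-th row is
`φ₁ᵢ(x₁), …, φₘᵢ(x₁), φ₁ᵢ(x₂), …, φₘᵢ(x₂), …, φ₁ᵢ(xₙ), …, φₘᵢ(xₙ)`. -/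
def blockMatrix {𝕜 : Type*} {m n : ℕ} (φ : Fin m → Fin (n * m) → ℝ → 𝕜) (x : Fin n → ℝ) :
    Matrix (Fin (n * m)) (Fin (n * m)) 𝕜 :=
  Matrix.of fun i c => φ (finProdFinEquiv.symm c).2 i (x (finProdFinEquiv.symm c).1)

/-- The real numbers between `a` and `b`, where `a` and `b` may be infinite. -/
def realInterval (a b : EReal) : Set ℝ :=
  {x | a ≤ (x : EReal) ∧ (x : EReal) ≤ b}

/-- The ordered simplex `a ≤ x₁ < ⋯ < xₙ ≤ b`. -/
def orderedSimplex (a b : EReal) (n : ℕ) : Set (Fin n → ℝ) :=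
  {x | StrictMono x ∧ ∀ j, x j ∈ realInterval a b}

end HyperDeBruijn

/-!
Both identities come from one expansion. Every permutation `τ` of the `n * m` indices factors
uniquely as `σ ∘ w`, where `σ` lies in `blockPerms m n` and `w` is an element of the wreath
product: it permutes the `n` blocks by some `π` and reorders inside the blocks by permutations
`ρ p` of the `m` places. For even `m` the sign of `w` is `∏ p, sign (ρ p)`, since permuting blocks
of even length is an even permutation. Summing over the `ρ p` first turns the Leibniz expansion
of the determinant into
`∑ σ, sign σ * ∑ π, ∏ p, g σ (π p) (x p)`, where `g σ q` is the antisymmetrised product of functions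
that stands under the integral in the hyperpfaffian.

The `n!` images of the open simplex `x₁ < ⋯ < xₙ` under permutations of the coordinates are
disjoint and cover almost all of the cube, so integrating the inner sum over `π` on the ordered
simplex gives the integral of `∏ p, g σ p (x p)` over the whole cube, and Fubini turns that into
`∏ p, ∫ g σ p`. The permanent is treated the same way with all signs replaced by `1`; the two cases
are unified by weights `W` on the permutations of the indices and `v` on those of a block.
-/

namespace HyperDeBruijn

/-! ### Factorization of permutations through block permutations -/

theorem exists_perm_strictMono_comp {α : Type*} [LinearOrder α] {n : ℕ} {f : Fin n → α}
    (hf : Function.Injective f) : ∃ ρ : Equiv.Perm (Fin n), StrictMono fun s => f (ρ s) :=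
  ⟨Tuple.sort f, (Tuple.monotone_sort f).strictMono_of_injective
    (hf.comp (Tuple.sort f).injective)⟩

theorem strictMono_comp_perm_inj {α : Type*} [LinearOrder α] {n : ℕ} {f g : Fin n → α}
    (hf : StrictMono f) (hg : StrictMono g) {ρ ρ' : Equiv.Perm (Fin n)}
    (h : ∀ s, f (ρ s) = g (ρ' s)) : f = g ∧ ρ = ρ' := by
  have hfg : f = g := by
    rw [← StrictMono.range_inj hf hg, ← ρ.surjective.range_comp f, ← ρ'.surjective.range_comp g]
    exact congrArg Set.range (funext h)
  subst hfg
  exact ⟨rfl, Equiv.ext fun s => hf.injective (h s)⟩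

/-- The element of the wreath product given by `ρ` and `π`, acting on positions: place `s` of
block `p` is sent to place `ρ p s` of block `π p`. -/
def wreathPerm {m n : ℕ} (ρ : Fin n → Equiv.Perm (Fin m)) (π : Equiv.Perm (Fin n)) :
    Equiv.Perm (Fin (n * m)) :=
  finProdFinEquiv.permCongr (Equiv.prodShear π ρ)

@[simp]
theorem wreathPerm_apply {m n : ℕ} (ρ : Fin n → Equiv.Perm (Fin m)) (π : Equiv.Perm (Fin n))
    (p : Fin n) (s : Fin m) :
    wreathPerm ρ π (finProdFinEquiv (p, s)) = finProdFinEquiv (π p, ρ p s) := by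
  simp [wreathPerm, Equiv.permCongr_apply, Equiv.prodShear]

theorem sign_wreathPerm {m n : ℕ} (hm : Even m) (ρ : Fin n → Equiv.Perm (Fin m))
    (π : Equiv.Perm (Fin n)) :
    Equiv.Perm.sign (wreathPerm ρ π) = ∏ p, Equiv.Perm.sign (ρ p) := by
  have h : (Equiv.prodShear π ρ : Equiv.Perm (Fin n × Fin m)) =
      Equiv.prodCongrLeft (fun _ : Fin m => π) * Equiv.prodCongrRight ρ := by
    ext ⟨p, s⟩ <;> rfl
  rw [wreathPerm, Equiv.Perm.sign_permCongr, h, Equiv.Perm.sign_mul,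
    Equiv.Perm.sign_prodCongrLeft, Equiv.Perm.sign_prodCongrRight, Finset.prod_const,
    Finset.card_univ, Fintype.card_fin, Int.units_pow_eq_pow_mod_two, Nat.even_iff.mp hm, pow_zero,
    one_mul]

theorem perm_ext_blocks {m n : ℕ} {σ τ : Equiv.Perm (Fin (n * m))}
    (h : ∀ p s, σ (finProdFinEquiv (p, s)) = τ (finProdFinEquiv (p, s))) : σ = τ := by
  ext1 i
  obtain ⟨⟨p, s⟩, rfl⟩ := finProdFinEquiv.surjective i
  exact h p s

/-- `blockPerms m n` is a system of representatives of the left cosets of the wreath product,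
in whose elements both factors `ρ` and `π` are determined. -/
theorem bijective_blockPerms_mul_wreathPerm {m n : ℕ} (hm : 0 < m) :
    Function.Bijective
      fun w : blockPerms m n × (Equiv.Perm (Fin n) × (Fin n → Equiv.Perm (Fin m))) =>
        (w.1 : Equiv.Perm (Fin (n * m))) * wreathPerm w.2.2 w.2.1 := by
  let z : Fin m := ⟨0, hm⟩
  have hz : ∀ s : Fin m, (s : ℕ) = 0 → s = z := fun s hs => Fin.ext hs
  constructor
  · rintro ⟨⟨σ, hσ⟩, π, ρ⟩ ⟨⟨σ', hσ'⟩, π', ρ'⟩ h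
    simp only [blockPerms, Finset.mem_filter, Finset.mem_univ, true_and] at hσ hσ'
    have key : ∀ p s, σ (finProdFinEquiv (π p, ρ p s)) = σ' (finProdFinEquiv (π' p, ρ' p s)) := by
      intro p s
      simpa using Equiv.congr_fun h (finProdFinEquiv (p, s))
    have hblock : ∀ p, (fun s => σ (finProdFinEquiv (π p, s))) =
        (fun s => σ' (finProdFinEquiv (π' p, s))) ∧ ρ p = ρ' p := fun p =>
      strictMono_comp_perm_inj (fun s t => hσ.1 (π p) s t) (fun s t => hσ'.1 (π' p) s t) (key p)
    have hπ : π = π' :=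
      (strictMono_comp_perm_inj (f := fun p => σ (finProdFinEquiv (p, z)))
        (g := fun p => σ' (finProdFinEquiv (p, z)))
        (fun p q hpq => hσ.2 p q hpq z rfl) (fun p q hpq => hσ'.2 p q hpq z rfl)
        (fun p => congrFun (hblock p).1 z)).2
    subst hπ
    have hρ : ρ = ρ' := funext fun p => (hblock p).2
    subst hρ
    have hσσ : σ = σ' := mul_right_cancel h
    subst hσσ
    rfl
  · intro τ
    -- Sort every block, then sort the blocks by their first entries.
    have hρ : ∀ p : Fin n, ∃ ρ : Equiv.Perm (Fin m),
        StrictMono fun s => τ (finProdFinEquiv (p, ρ s)) := fun p =>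
      exists_perm_strictMono_comp (f := fun s => τ (finProdFinEquiv (p, s)))
        fun s t hst => by simpa using hst
    choose ρ hρ using hρ
    obtain ⟨π, hπ⟩ := exists_perm_strictMono_comp
      (f := fun p => τ (finProdFinEquiv (p, ρ p z))) fun p q hpq => by
        have := finProdFinEquiv.injective (τ.injective hpq)
        exact (Prod.ext_iff.mp this).1
    refine ⟨⟨⟨τ * wreathPerm (fun p => ρ (π p)) π, ?_⟩, π⁻¹, fun p => (ρ p)⁻¹⟩, ?_⟩
    · simp only [blockPerms, Finset.mem_filter, Finset.mem_univ, true_and, Equiv.Perm.mul_apply,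
        wreathPerm_apply]
      refine ⟨fun p s t hst => hρ (π p) hst, fun p q hpq s hs => ?_⟩
      rw [hz s hs]
      exact hπ hpq
    · refine perm_ext_blocks fun p s => ?_
      simp

/-- The Leibniz-type sum over all permutations, regrouped along the cosets of the wreath
product. Here `W` and `v` are weights compatible with the factorization. -/
theorem sum_perm_eq_sum_blockPerms {R : Type*} [CommRing R] {m n : ℕ} (hm : 0 < m)
    (W : Equiv.Perm (Fin (n * m)) → R) (v : Equiv.Perm (Fin m) → R)
    (hW : ∀ σ ρ π, W (σ * wreathPerm ρ π) = W σ * ∏ p, v (ρ p))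
    (F : Fin n → Fin m → Fin (n * m) → R) :
    ∑ τ, W τ * ∏ p, ∏ s, F p s (τ (finProdFinEquiv (p, s))) =
      ∑ σ ∈ blockPerms m n, W σ * ∑ π : Equiv.Perm (Fin n), ∏ p,
        ∑ ρ : Equiv.Perm (Fin m), v ρ * ∏ s, F p s (σ (finProdFinEquiv (π p, ρ s))) := by
  rw [← (bijective_blockPerms_mul_wreathPerm hm).sum_comp, Fintype.sum_prod_type,
    ← Finset.sum_coe_sort (blockPerms m n)]
  refine Finset.sum_congr rfl fun σ _ => ?_
  rw [Fintype.sum_prod_type, Finset.mul_sum]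
  refine Finset.sum_congr rfl fun π _ => ?_
  rw [Fintype.prod_sum, Finset.mul_sum]
  refine Finset.sum_congr rfl fun ρ _ => ?_
  simp only [hW, Equiv.Perm.mul_apply, wreathPerm_apply, Finset.prod_mul_distrib, mul_assoc]

/-! ### Integration over the ordered simplex -/

theorem ae_injective_pi (n : ℕ) : ∀ᵐ x : Fin n → ℝ, Function.Injective x := by
  -- Each diagonal `x i = x j` is a proper linear subspace, hence a null set.
  have h : ∀ i j : Fin n, i ≠ j → ∀ᵐ x : Fin n → ℝ, x i ≠ x j := by
    intro i j hij
    let L : (Fin n → ℝ) →ₗ[ℝ] ℝ := 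
      LinearMap.proj (R := ℝ) (φ := fun _ : Fin n => ℝ) i - LinearMap.proj j
    have hL : LinearMap.ker L ≠ ⊤ := by
      intro h
      have h1 : Pi.single i (1 : ℝ) ∈ LinearMap.ker L := h ▸ Submodule.mem_top
      simp [L, hij.symm] at h1
    have h0 := Measure.addHaar_submodule (volume : Measure (Fin n → ℝ)) _ hL
    rw [ae_iff]
    convert h0 using 2
    ext x
    simp [L, sub_eq_zero]
  have h' : ∀ᵐ x : Fin n → ℝ, ∀ i j : Fin n, i ≠ j → x i ≠ x j := by
    simpa only [ae_all_iff] using h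
  filter_upwards [h'] with x hx i j hij
  by_contra hne
  exact hx i j hne hij

theorem measurableSet_strictMono (n : ℕ) : MeasurableSet {x : Fin n → ℝ | StrictMono x} := by
  -- A finite intersection of the conditions `x i < x j`.
  simp only [StrictMono, Set.ofPred_forall]
  exact MeasurableSet.iInter fun i => MeasurableSet.iInter fun j => MeasurableSet.iInter fun _ =>
    measurableSet_lt (measurable_pi_apply i) (measurable_pi_apply j)

theorem restrict_strictMono_pi (n : ℕ) (S : Set ℝ) :
    (volume : Measure (Fin n → ℝ)).restrict {x | StrictMono x ∧ ∀ j, x j ∈ S} =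
      (Measure.pi fun _ : Fin n => (volume : Measure ℝ).restrict S).restrict
        {x | StrictMono x} := by
  rw [← Measure.restrict_pi_pi, Measure.restrict_restrict (measurableSet_strictMono n)]
  congr 1
  ext x
  simp

theorem integrableOn_strictMono_prod {𝕜 : Type*} [RCLike 𝕜] {n : ℕ} {S : Set ℝ}
    {g : Fin n → ℝ → 𝕜} (hg : ∀ p, IntegrableOn (g p) S) :
    IntegrableOn (fun x : Fin n → ℝ => ∏ p, g p (x p)) {x | StrictMono x ∧ ∀ j, x j ∈ S} := by
  rw [IntegrableOn, restrict_strictMono_pi]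
  exact (Integrable.fintype_prod_dep hg).restrict

/-- Symmetrizing a product function and integrating over the ordered part of a cube gives the
product of the one-dimensional integrals: the orderings of the coordinates split the cube, up to
a null set. -/
theorem sum_perm_integral_strictMono {𝕜 : Type*} [RCLike 𝕜] {n : ℕ} {S : Set ℝ}
    {g : Fin n → ℝ → 𝕜} (hg : ∀ p, IntegrableOn (g p) S) :
    ∑ π : Equiv.Perm (Fin n), ∫ x in {x : Fin n → ℝ | StrictMono x ∧ ∀ j, x j ∈ S},
      ∏ p, g (π p) (x p) = ∏ p, ∫ x in S, g p x := by
  let μ : Measure (Fin n → ℝ) := Measure.pi fun _ : Fin n => (volume : Measure ℝ).restrict S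
  let A : Equiv.Perm (Fin n) → Set (Fin n → ℝ) := fun π => {y | StrictMono fun p => y (π p)}
  have hA : ∀ π, MeasurableSet (A π) := fun π =>
    (measurable_pi_lambda (fun (y : Fin n → ℝ) p => y (π p))
      fun p => measurable_pi_apply (π p)) (measurableSet_strictMono n)
  have hint : Integrable (fun y : Fin n → ℝ => ∏ p, g p (y p)) μ := Integrable.fintype_prod_dep hg
  have hsub : ∀ π : Equiv.Perm (Fin n),
      ∫ x in {x : Fin n → ℝ | StrictMono x ∧ ∀ j, x j ∈ S}, ∏ p, g (π p) (x p) =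
        ∫ y in A π, ∏ p, g p (y p) ∂μ := by
    intro π
    -- Change variables by `y (π p) = x p`.
    let e := MeasurableEquiv.piCongrLeft (fun _ : Fin n => ℝ) π
    have he : ∀ (x : Fin n → ℝ) p, e x (π p) = x p := fun x p =>
      MeasurableEquiv.piCongrLeft_apply_apply (β := fun _ : Fin n => ℝ) π x p
    have hmp : MeasurePreserving e μ μ :=
      measurePreserving_piCongrLeft (fun _ : Fin n => (volume : Measure ℝ).restrict S) π
    rw [restrict_strictMono_pi, ← hmp.setIntegral_preimage_emb e.measurableEmbedding
      (fun y => ∏ p, g p (y p)) (A π)]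
    have hpre : e ⁻¹' A π = {x | StrictMono x} := by
      ext x
      simp [A, he]
    rw [hpre]
    refine integral_congr_ae (Filter.Eventually.of_forall fun x => ?_)
    simp only
    rw [← Equiv.prod_comp π fun q => g q (e x q)]
    simp only [he]
  have hdisj : Pairwise (Function.onFun Disjoint A) := by
    intro π π' hne
    rw [Function.onFun, Set.disjoint_left]
    intro y hy hy'
    have hy1 : Function.Injective y := by
      intro i j hij
      obtain ⟨i, rfl⟩ := π.surjective i
      obtain ⟨j, rfl⟩ := π.surjective j
      exact congrArg π (StrictMono.injective hy hij)
    have h := (strictMono_comp_perm_inj (ρ := π⁻¹) (ρ' := π'⁻¹) hy hy' fun s => by simp).2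
    exact hne (inv_injective h)
  have hcover : (⋃ π, A π) =ᵐ[μ] Set.univ := by
    have hinj : ∀ᵐ y ∂μ, Function.Injective y := by
      have : μ = (volume : Measure (Fin n → ℝ)).restrict (Set.univ.pi fun _ => S) :=
        (Measure.restrict_pi_pi _ _).symm
      rw [this]
      exact ae_restrict_of_ae (ae_injective_pi n)
    rw [Filter.eventuallyEq_univ]
    filter_upwards [hinj] with y hy
    obtain ⟨π, hπ⟩ := exists_perm_strictMono_comp hy
    exact Set.mem_iUnion.mpr ⟨π, hπ⟩
  rw [Finset.sum_congr rfl fun π _ => hsub π,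
    ← integral_iUnion_fintype hA hdisj fun π => hint.integrableOn, setIntegral_congr_set hcover,
    setIntegral_univ]
  exact integral_fintype_prod_eq_prod _

/-! ### The weighted de Bruijn formula -/

/-- The common form of the two identities: the determinant is the case of sign weights, the
permanent that of weights `1`. -/
theorem integral_weighted_sum_perm {𝕜 : Type*} [RCLike 𝕜] {m n : ℕ} (hm : 0 < m) (S : Set ℝ)
    (φ : Fin m → Fin (n * m) → ℝ → 𝕜)
    (hφ : ∀ i : Fin m → Fin (n * m), Function.Injective i →
      IntegrableOn (fun x => ∏ s, φ s (i s) x) S)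
    (W : Equiv.Perm (Fin (n * m)) → 𝕜) (v : Equiv.Perm (Fin m) → 𝕜)
    (hW : ∀ σ ρ π, W (σ * wreathPerm ρ π) = W σ * ∏ p, v (ρ p)) :
    IntegrableOn (fun x : Fin n → ℝ => ∑ τ, W τ * ∏ c, blockMatrix φ x (τ c) c)
        {x | StrictMono x ∧ ∀ j, x j ∈ S} ∧
      ∫ x in {x : Fin n → ℝ | StrictMono x ∧ ∀ j, x j ∈ S},
          ∑ τ, W τ * ∏ c, blockMatrix φ x (τ c) c =
        ∑ σ ∈ blockPerms m n, W σ * ∏ p : Fin n, ∫ x in S,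
          ∑ ρ : Equiv.Perm (Fin m), v ρ * ∏ s, φ s (σ (finProdFinEquiv (p, ρ s))) x := by
  let g : Equiv.Perm (Fin (n * m)) → Fin n → ℝ → 𝕜 := fun σ q x =>
    ∑ ρ : Equiv.Perm (Fin m), v ρ * ∏ s, φ s (σ (finProdFinEquiv (q, ρ s))) x
  have hg : ∀ σ q, IntegrableOn (g σ q) S := fun σ q =>
    integrable_finsetSum _ fun ρ _ => Integrable.const_mul
      (hφ (fun s => σ (finProdFinEquiv (q, ρ s))) fun s t hst => by simpa using hst) (v ρ)
  have hsum : ∀ x : Fin n → ℝ, ∑ τ, W τ * ∏ c, blockMatrix φ x (τ c) c =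
      ∑ σ ∈ blockPerms m n, W σ * ∑ π : Equiv.Perm (Fin n), ∏ p, g σ (π p) (x p) := by
    intro x
    rw [← sum_perm_eq_sum_blockPerms hm W v hW fun p s i => φ s i (x p)]
    refine Finset.sum_congr rfl fun τ _ => ?_
    rw [← finProdFinEquiv.prod_comp, Fintype.prod_prod_type]
    simp only [blockMatrix, Matrix.of_apply, Equiv.symm_apply_apply]
  have hprod : ∀ σ (π : Equiv.Perm (Fin n)),
      IntegrableOn (fun x : Fin n → ℝ => ∏ p, g σ (π p) (x p))
        {x | StrictMono x ∧ ∀ j, x j ∈ S} := fun σ π =>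
    integrableOn_strictMono_prod fun p => hg σ (π p)
  have hterm : ∀ σ, IntegrableOn
      (fun x : Fin n → ℝ => W σ * ∑ π : Equiv.Perm (Fin n), ∏ p, g σ (π p) (x p))
        {x | StrictMono x ∧ ∀ j, x j ∈ S} := fun σ =>
    (integrable_finsetSum _ fun π _ => hprod σ π).const_mul (W σ)
  simp only [hsum]
  refine ⟨integrable_finsetSum _ fun σ _ => hterm σ, ?_⟩
  rw [integral_finsetSum _ fun σ _ => hterm σ]
  refine Finset.sum_congr rfl fun σ _ => ?_
  rw [integral_const_mul, integral_finsetSum _ fun π _ => hprod σ π,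
    sum_perm_integral_strictMono (hg σ)]

end HyperDeBruijn

theorem mainTheorem5 {𝕜 : Type*} [RCLike 𝕜] (k n : ℕ) (hk : 0 < k)
    (a b : EReal) (hab : a ≤ b)
    (φ : Fin (2 * k) → Fin (n * (2 * k)) → ℝ → 𝕜)
    (hφ : ∀ i : Fin (2 * k) → Fin (n * (2 * k)), Function.Injective i →
      IntegrableOn (fun x => ∏ s, φ s (i s) x) (HyperDeBruijn.realInterval a b)) :
    (IntegrableOn (fun x : Fin n → ℝ => (HyperDeBruijn.blockMatrix φ x).det)
        (HyperDeBruijn.orderedSimplex a b n) ∧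
      ∫ x in HyperDeBruijn.orderedSimplex a b n, (HyperDeBruijn.blockMatrix φ x).det =
        HyperDeBruijn.hyperpfaffian (2 * k) n fun i =>
          ∫ x in HyperDeBruijn.realInterval a b,
            ∑ σ : Equiv.Perm (Fin (2 * k)),
              ((Equiv.Perm.sign σ : ℤ) : 𝕜) * ∏ s, φ s (i (σ s)) x) ∧
    (IntegrableOn (fun x : Fin n → ℝ => (HyperDeBruijn.blockMatrix φ x).permanent)
        (HyperDeBruijn.orderedSimplex a b n) ∧
      ∫ x in HyperDeBruijn.orderedSimplex a b n, (HyperDeBruijn.blockMatrix φ x).permanent =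
        HyperDeBruijn.hyperhafnian (2 * k) n fun i =>
          ∫ x in HyperDeBruijn.realInterval a b,
            ∑ σ : Equiv.Perm (Fin (2 * k)), ∏ s, φ s (i (σ s)) x) := by
  have hm : 0 < 2 * k := by omega
  constructor
  · have h := HyperDeBruijn.integral_weighted_sum_perm hm (HyperDeBruijn.realInterval a b) φ hφ
      (fun τ => ((Equiv.Perm.sign τ : ℤ) : 𝕜)) (fun ρ => ((Equiv.Perm.sign ρ : ℤ) : 𝕜))
      (fun σ ρ π => by simp [HyperDeBruijn.sign_wreathPerm (even_two_mul k)])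
    simp only [Matrix.det_apply']
    exact h
  · have h := HyperDeBruijn.integral_weighted_sum_perm hm (HyperDeBruijn.realInterval a b) φ hφ
      (fun _ => 1) (fun _ => 1) (fun σ ρ π => by simp)
    simp only [one_mul] at h
    exact h
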